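/- **Theorem.** For every nondeterministic Büchi automaton $A$, the automaton $A_{Schewe}$ defined below satisfies $L(A_{Schewe})=\Sigma^\omega\setminus L(A)$. A *nondeterministic Büchi word automaton* (NBW) is a tuple $A=\langle\Sigma,Q,Q^{in},\rho,F\rangle$ with a finite alphabet $\Sigma$, a finite set $Q$ of states, $Q^{in}\subseteq Q$, $\rho\colon Q\times\Sigma\to 2^Q$ and $F\subseteq Q$. A word $w=\sigma_0\sigma_1\cdots\in\Sigma^\omega$ is in $L(A)$ iff there are $p_0,p_1,\dots\in Q$ with $p_0\in Q^{in}$, $p_{i+1}\in\rho(p_i,\sigma_i)$ for all $i$, and $p_i\in F$ for infinitely many $i$. Write $\rho(R,\sigma)=\bigcup_{q\in R}\rho(q,\sigma)$ and $m=2|Q\setminus F|$. *Preordered subsets.* Let $\mathbf Q$ be the set of pairs $\langle S,\preceq\rangle$ with $S\subseteq Q$ and $\preceq$ a total preorder on $S$; $\prec$ and $\approx$ are its strict part and its equivalence. For $q\in S$ let $\rho_{\langle S,\preceq\rangle}(q,\sigma)=\{r\in\rho(q,\sigma): q'\preceq q \text{ for all } q'\in S \text{ with } r\in\rho(q',\sigma)\}$.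 The $\sigma$-successor of $\langle S,\preceq\rangle$ is $\langle\rho(S,\sigma),\preceq'\rangle$, where for $q,r\in S$, $q'\in\rho_{\langle S,\preceq\rangle}(q,\sigma)$, $r'\in\rho_{\langle S,\preceq\rangle}(r,\sigma)$: if $q\prec r$ then $q'\prec' r'$; if $q\approx r$ and $q',r'$ are both in $F$ or both outside $F$, then $q'\approx' r'$; if $q\approx r$, $q'\notin F$ and $r'\in F$, then $q'\prec' r'$. *Level rankings.* Let $\mathcal R^m$ be the set of functions $f\colon Q\to\{0,\dots,m,\bot\}$ such that $f(q)$ is even or $\bot$ for $q\in F$. Let $odd(f)$ be the set of states of odd rank, and $\mathrm{maxrank}(f)$ the largest rank in $f$ ($0$ if $f\equiv\bot$). For $\mathcal S=\langle S,\preceq\rangle\in\mathbf Q$ and $q\in S$ let $c(q)$ be the number of $\approx$-classes $[v]$ with $v\in S\setminus F$ and $q\prec v$; define $\mathrm{torank}(\mathcal S)(q)$ as $\bot$ if $q\notin S$, as $2c(q)$ if $q\in S\cap F$, and as $2c(q)+1$ if $q\in S\setminus F$. For $f\in\mathcal R^m$ with $f(q)\ne\bot$ let $\gamma(q)$ be the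 number of odd values of $f$ that are less than $f(q)$; define $\mathrm{tighten}(f)(q)$ as $\bot$ if $f(q)=\bot$, as $2\gamma(q)$ if $f(q)$ is even, and as $2\gamma(q)+1$ if $f(q)$ is odd. The $\sigma$-successor of $f$ is $\mathrm{tighten}(g)$, where, with $M(q')=\{f(q): f(q)\neq\bot,\ q'\in\rho(q,\sigma)\}$, $g(q')=\bot$ if $M(q')=\emptyset$, and otherwise $g(q')=\min M(q')$ if $q'\notin F$, and $g(q')$ is the largest even number $\le\min M(q')$ if $q'\in F$. *The automaton.* $A_{Schewe}$ is the NBW over $\Sigma$ with states $\mathbf Q\cup(\mathcal R^m\times 2^Q\times\{0,\dots,m\})$; its only initial state is $\langle Q^{in},\preceq^{in}\rangle$, where $q\preceq^{in} r$ iff $q\notin F$ or $r\in F$; its accepting states are the $\langle f,\emptyset,0\rangle$ with $f\in\mathcal R^m$. From $\mathcal S\in\mathbf Q$ with $\sigma$-successor $\mathcal S'$, the letter $\sigma$ leads to $\mathcal S'$ and to $\langle\mathrm{torank}(\mathcal S'),\emptyset,0\rangle$. From $\langle f,O,i\rangle$, the letter $\sigma$ leads only to $\langle f',O',i'\rangle$,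 where $f'$ is the $\sigma$-successor of $f$; if $O\neq\emptyset$ then $i'=i$ and $O'=\rho(O,\sigma)\setminus odd(f')$; and if $O=\emptyset$ then $i'=(i+2)\bmod(\mathrm{maxrank}(f')+1)$ and $O'=\{q: f'(q)=i'\}$. -/

import Mathlib

/-- A nondeterministic Büchi word automaton over the finite alphabet `α` with finite state set
`Q`: initial states, transition relation `ρ`, accepting states `F`. -/
structure NBW (α Q : Type*) [Finite α] [Finite Q] where
  init : Set Q
  ρ : Q → α → Set Q
  F : Set Q

namespace NBW

variable {α Q : Type*} [Finite α] [Finite Q]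

/-- `p` is an infinite run of `A` on the infinite word `w`. -/
def IsRun (A : NBW α Q) (w : ℕ → α) (p : ℕ → Q) : Prop :=
  p 0 ∈ A.init ∧ ∀ i, p (i + 1) ∈ A.ρ (p i) (w i)

/-- The language of `A`: the infinite words on which some run visits `F` infinitely often. -/
def language (A : NBW α Q) : Set (ℕ → α) :=
  {w | ∃ p : ℕ → Q, A.IsRun w p ∧ {i | p i ∈ A.F}.Infinite}

/-- The transition relation lifted to sets of states. -/
def post (A : NBW α Q) (R : Set Q) (σ : α) : Set Q :=
  {q' | ∃ q ∈ R, q' ∈ A.ρ q σ}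

end NBW

/-! ### Preordered subsets -/

/-- A subset `S` of `Q` with a (total) preorder `le` over `S`. The relation `le` is supported on
`S`, so that equal preorders over `S` are equal relations. -/
@[ext] structure PreorderedSubset (Q : Type*) where
  S : Set Q
  le : Q → Q → Prop
  supp : ∀ q r, le q r → q ∈ S ∧ r ∈ S
  trans : ∀ q r s, le q r → le r s → le q s
  total : ∀ q ∈ S, ∀ r ∈ S, le q r ∨ le r q

namespace PreorderedSubset

variable {Q : Type*}

/-- The strict part of the preorder. -/
def lt (P : PreorderedSubset Q) (q r : Q) : Prop := P.le q r ∧ ¬ P.le r q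

/-- The equivalence of the preorder. -/
def equiv (P : PreorderedSubset Q) (q r : Q) : Prop := P.le q r ∧ P.le r q

/-- The equivalence class of a state. -/
def cls (P : PreorderedSubset Q) (v : Q) : Set Q := {u | P.equiv v u}

instance [Finite Q] : Finite (PreorderedSubset Q) :=
  Finite.of_injective
    (fun P : PreorderedSubset Q => ((P.S, P.le) : Set Q × (Q → Q → Prop)))
    (by
      intro P P' h
      exact PreorderedSubset.ext (congrArg Prod.fst h) (congrArg Prod.snd h))

end PreorderedSubset

namespace NBW

variable {α Q : Type*} [Finite α] [Finite Q]

/-- The preordered subset of initial states: `q ≼ r` iff `q ∉ F` or `r ∈ F`. -/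
def initPreordered (A : NBW α Q) : PreorderedSubset Q where
  S := A.init
  le q r := q ∈ A.init ∧ r ∈ A.init ∧ (q ∉ A.F ∨ r ∈ A.F)
  supp _ _ h := ⟨h.1, h.2.1⟩
  trans := by tauto
  total := by tauto

/-- The `σ`-successors `r` of `q ∈ S` for which `q` is a maximal predecessor in `S`. -/
def maxPost (A : NBW α Q) (P : PreorderedSubset Q) (q : Q) (σ : α) : Set Q :=
  {r | r ∈ A.ρ q σ ∧ ∀ q' ∈ P.S, r ∈ A.ρ q' σ → P.le q' q}

/-- The order on the `σ`-successor: states are compared by their maximal predecessors, and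
between successors of equivalent states those in `F` are larger than those outside `F`. -/
def succLe (A : NBW α Q) (P : PreorderedSubset Q) (σ : α) (q' r' : Q) : Prop :=
  ∃ q ∈ P.S, ∃ r ∈ P.S, q' ∈ A.maxPost P q σ ∧ r' ∈ A.maxPost P r σ ∧
    (P.lt q r ∨ (P.equiv q r ∧ (q' ∈ A.F → r' ∈ A.F)))

theorem exists_maxPost (A : NBW α Q) (P : PreorderedSubset Q) (σ : α) {q' : Q}
    (h : q' ∈ A.post P.S σ) : ∃ q ∈ P.S, q' ∈ A.maxPost P q σ := by
  classical
  let T : Set Q := {q | q ∈ P.S ∧ q' ∈ A.ρ q σ}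
  suffices H : ∀ U : Set Q, U.Finite → U ⊆ T → U.Nonempty → ∃ q ∈ U, ∀ r ∈ U, P.le r q by
    obtain ⟨q, hq, hmax⟩ := H T (Set.toFinite T) subset_rfl h
    exact ⟨q, hq.1, hq.2, fun r hr hr' => hmax r ⟨hr, hr'⟩⟩
  intro U hU
  induction U, hU using Set.Finite.induction_on with
  | empty => intro _ hne; exact absurd hne (by simp)
  | @insert a U ha hU ih =>
    intro hsub _
    have haS : a ∈ P.S := (hsub (Set.mem_insert a U)).1
    have haa : P.le a a := (P.total a haS a haS).elim id id
    rcases U.eq_empty_or_nonempty with rfl | hne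
    · exact ⟨a, by simp, by simpa using haa⟩
    · obtain ⟨q, hq, hmax⟩ := ih (fun x hx => hsub (Set.mem_insert_of_mem a hx)) hne
      have hqS : q ∈ P.S := (hsub (Set.mem_insert_of_mem a hq)).1
      rcases P.total a haS q hqS with h1 | h1
      · refine ⟨q, Set.mem_insert_of_mem a hq, ?_⟩
        rintro r (rfl | hr)
        · exact h1
        · exact hmax r hr
      · refine ⟨a, Set.mem_insert a U, ?_⟩
        rintro r (rfl | hr)
        · exact haa
        · exact P.trans r q a (hmax r hr) h1

/-- The `σ`-successor of a preordered subset. -/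
def succPreordered (A : NBW α Q) (P : PreorderedSubset Q) (σ : α) : PreorderedSubset Q where
  S := A.post P.S σ
  le := A.succLe P σ
  supp := by
    rintro q' r' ⟨q, hq, r, hr, hq', hr', -⟩
    exact ⟨⟨q, hq, hq'.1⟩, ⟨r, hr, hr'.1⟩⟩
  trans := by
    rintro q' r' s' ⟨q, hq, r, hr, hq', hr', h⟩ ⟨t, ht, s, hs, ht', hs', h'⟩
    have hrt : P.le r t := ht'.2 r hr hr'.1
    have htr : P.le t r := hr'.2 t ht ht'.1
    have tr := P.trans
    refine ⟨q, hq, s, hs, hq', hs', ?_⟩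
    unfold PreorderedSubset.lt PreorderedSubset.equiv at *
    have h1 : P.le q r := h.elim (fun x => x.1) (fun x => x.1.1)
    have h2 : P.le t s := h'.elim (fun x => x.1) (fun x => x.1.1)
    have hqs : P.le q s := tr q t s (tr q r t h1 hrt) h2
    by_cases hsq : P.le s q
    · have hrq : P.le r q := tr r t q hrt (tr t s q h2 hsq)
      have hst : P.le s t := tr s r t (tr s q r hsq h1) hrt
      right
      refine ⟨⟨hqs, hsq⟩, fun hF => ?_⟩
      rcases h with h | h
      · exact absurd hrq h.2
      · rcases h' with h' | h'
        · exact absurd hst h'.2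
        · exact h'.2 (h.2 hF)
    · exact Or.inl ⟨hqs, hsq⟩
  total := by
    intro q' hq' r' hr'
    obtain ⟨q, hq, hqq⟩ := A.exists_maxPost P σ hq'
    obtain ⟨r, hr, hrr⟩ := A.exists_maxPost P σ hr'
    have ht := P.total q hq r hr
    by_cases h1 : P.le q r <;> by_cases h2 : P.le r q
    · by_cases hF : q' ∈ A.F → r' ∈ A.F
      · exact Or.inl ⟨q, hq, r, hr, hqq, hrr, Or.inr ⟨⟨h1, h2⟩, hF⟩⟩
      · exact Or.inr ⟨r, hr, q, hq, hrr, hqq, Or.inr ⟨⟨h2, h1⟩, by tauto⟩⟩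
    · exact Or.inl ⟨q, hq, r, hr, hqq, hrr, Or.inl ⟨h1, h2⟩⟩
    · exact Or.inr ⟨r, hr, q, hq, hrr, hqq, Or.inl ⟨h2, h1⟩⟩
    · tauto

/-! ### Level rankings -/

/-- The bound `m = 2|Q ∖ F|` on the ranks. -/
noncomputable def rankBound (A : NBW α Q) : ℕ := 2 * (A.F)ᶜ.ncard

/-- An `m`-bounded level ranking `Q → {0, …, m, ⊥}`, with `⊥` written `none`: states of `F`
have even rank or rank `⊥`. -/
@[ext] structure LevelRanking (A : NBW α Q) where
  rank : Q → Option ℕ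
  bounded : ∀ q n, rank q = some n → n ≤ A.rankBound
  even_of_mem : ∀ q n, q ∈ A.F → rank q = some n → Even n

namespace LevelRanking

variable {A : NBW α Q}

instance : Finite (LevelRanking A) := by
  have hfin : Finite {x : Option ℕ // ∀ n, x = some n → n ≤ A.rankBound} := by
    refine Set.Finite.to_subtype (Set.Finite.subset
      ((Set.finite_Iic A.rankBound).image some |>.insert none) ?_)
    intro x hx
    cases x with
    | none => exact Set.mem_insert _ _
    | some n => exact Set.mem_insert_of_mem _ ⟨n, hx n rfl, rfl⟩
  refine Finite.of_injective
    (fun (f : LevelRanking A) (q : Q) =>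
      (⟨f.rank q, f.bounded q⟩ : {x : Option ℕ // ∀ n, x = some n → n ≤ A.rankBound})) ?_
  intro f g h
  ext1
  funext q
  exact congrArg Subtype.val (congrFun h q)

/-- The states of odd rank. -/
def odd (f : LevelRanking A) : Set Q := {q | ∃ n, f.rank q = some n ∧ Odd n}

/-- The largest rank in `f` (and `0` if every state has rank `⊥`). -/
noncomputable def maxRank (f : LevelRanking A) : ℕ := sSup {n | ∃ q, f.rank q = some n}

theorem maxRank_le (f : LevelRanking A) : f.maxRank ≤ A.rankBound := by
  rcases Set.eq_empty_or_nonempty {n | ∃ q, f.rank q = some n} with h | h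
  · simp [maxRank, h]
  · exact csSup_le h (fun n ⟨q, hq⟩ => f.bounded q n hq)

/-- The number of odd ranks in the range of `f` that are lower than `r`. -/
noncomputable def numOddBelow (f : LevelRanking A) (r : ℕ) : ℕ :=
  {s | Odd s ∧ s < r ∧ ∃ q, f.rank q = some s}.ncard

theorem numOddBelow_le (f : LevelRanking A) (r : ℕ) : f.numOddBelow r ≤ r / 2 := by
  have h : {s | Odd s ∧ s < r ∧ ∃ q, f.rank q = some s} ⊆
      (fun j => 2 * j + 1) '' (Finset.range (r / 2) : Set ℕ) := by
    rintro s ⟨⟨j, rfl⟩, hs, -⟩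
    exact ⟨j, by simp; omega, rfl⟩
  calc f.numOddBelow r
      ≤ ((fun j => 2 * j + 1) '' (Finset.range (r / 2) : Set ℕ)).ncard :=
        Set.ncard_le_ncard h ((Finset.finite_toSet _).image _)
    _ ≤ (Finset.range (r / 2) : Set ℕ).ncard := Set.ncard_image_le (Finset.finite_toSet _)
    _ = r / 2 := by rw [Set.ncard_coe_finset, Finset.card_range]

open Classical in
/-- Close the gaps between the odd ranks: a state of even rank gets rank `2γ` and a state of odd
rank gets rank `2γ + 1`, where `γ` is the number of odd ranks in the range of `f` below its
rank. -/
noncomputable def tighten (f : LevelRanking A) : LevelRanking A where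
  rank q := (f.rank q).map fun r =>
    if Even r then 2 * f.numOddBelow r else 2 * f.numOddBelow r + 1
  bounded := by
    intro q n h
    obtain ⟨r, hr, rfl⟩ := Option.map_eq_some_iff.1 h
    have h1 := f.bounded q r hr
    have h2 := f.numOddBelow_le r
    split_ifs with he
    · omega
    · rw [Nat.not_even_iff_odd] at he
      obtain ⟨j, rfl⟩ := he
      omega
  even_of_mem := by
    intro q n hq h
    obtain ⟨r, hr, rfl⟩ := Option.map_eq_some_iff.1 h
    simp [f.even_of_mem q r hq hr]

/-- The ranks of the states of rank other than `⊥` that have `q'` as a `σ`-successor. -/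
def predRanks (f : LevelRanking A) (σ : α) (q' : Q) : Set ℕ :=
  {n | ∃ q, f.rank q = some n ∧ q' ∈ A.ρ q σ}

open Classical in
/-- Each state inherits the minimal rank of its predecessors, rounded down to an even number for
states of `F`; states without predecessors get `⊥`. -/
noncomputable def inherit (f : LevelRanking A) (σ : α) : LevelRanking A where
  rank q' :=
    if f.predRanks σ q' = ∅ then none
    else if q' ∈ A.F then some (sInf (f.predRanks σ q') - sInf (f.predRanks σ q') % 2)
    else some (sInf (f.predRanks σ q'))
  bounded := by
    intro q' n h
    split_ifs at h with h0 hF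
    all_goals
      obtain ⟨q, hq, -⟩ := Nat.sInf_mem (Set.nonempty_iff_ne_empty.2 h0)
      have h1 := f.bounded q _ hq
      simp only [Option.some.injEq] at h
      omega
  even_of_mem := by
    intro q' n hF h
    split_ifs at h with h0
    simp only [Option.some.injEq] at h
    rw [Nat.even_iff]
    omega

/-- The `σ`-successor of a level ranking. -/
noncomputable def succ (f : LevelRanking A) (σ : α) : LevelRanking A := (f.inherit σ).tighten

end LevelRanking

/-- The number of classes of states of `S ∖ F` that are larger than `q`. -/
noncomputable def preRank (A : NBW α Q) (P : PreorderedSubset Q) (q : Q) : ℕ :=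
  {C : Set Q | ∃ v ∈ P.S \ A.F, P.lt q v ∧ C = P.cls v}.ncard

theorem preRank_le (A : NBW α Q) (P : PreorderedSubset Q) (q : Q) :
    A.preRank P q ≤ {v | v ∈ P.S \ A.F ∧ P.lt q v}.ncard := by
  have h : {C : Set Q | ∃ v ∈ P.S \ A.F, P.lt q v ∧ C = P.cls v} =
      P.cls '' {v | v ∈ P.S \ A.F ∧ P.lt q v} := by
    ext C
    constructor
    · rintro ⟨v, hv, hlt, rfl⟩
      exact ⟨v, ⟨hv, hlt⟩, rfl⟩
    · rintro ⟨v, ⟨hv, hlt⟩, rfl⟩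
      exact ⟨v, hv, hlt, rfl⟩
  rw [preRank, h]
  exact Set.ncard_image_le (Set.toFinite _)

open Classical in
/-- The level ranking with which the second stage starts: `⊥` outside `S`, and for `q ∈ S` twice
the number of larger non-`F`-classes, plus one if `q ∉ F`. -/
noncomputable def toRank (A : NBW α Q) (P : PreorderedSubset Q) : LevelRanking A where
  rank q :=
    if q ∉ P.S then none
    else if q ∈ A.F then some (2 * A.preRank P q)
    else some (2 * A.preRank P q + 1)
  bounded := by
    intro q n h
    have h1 := A.preRank_le P q
    unfold rankBound
    split_ifs at h with hS hF
    · have h2 : {v | v ∈ P.S \ A.F ∧ P.lt q v}.ncard ≤ (A.F)ᶜ.ncard :=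
        Set.ncard_le_ncard (fun v hv => hv.1.2) (Set.toFinite _)
      simp only [Option.some.injEq] at h
      omega
    · have h2 : {v | v ∈ P.S \ A.F ∧ P.lt q v}.ncard < (A.F)ᶜ.ncard := by
        refine Set.ncard_lt_ncard ⟨fun v hv => hv.1.2, fun hsub => ?_⟩ (Set.toFinite _)
        have h3 := (hsub hF).2
        exact h3.2 h3.1
      simp only [Option.some.injEq] at h
      omega
  even_of_mem := by
    intro q n hF h
    split_ifs at h with hS
    simp only [Option.some.injEq] at h
    exact ⟨A.preRank P q, by omega⟩

/-! ### The complement automaton -/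

/-- States of the complement automaton: preordered subsets (first stage), and triples of a level
ranking, an obligation set and the rank being checked (second stage). -/
abbrev ScheweState (A : NBW α Q) : Type _ :=
  PreorderedSubset Q ⊕ (LevelRanking A × Set Q × Fin (A.rankBound + 1))

open Classical in
/-- The next rank to be checked, where `f'` is the next level ranking. -/
noncomputable def nextIndex (A : NBW α Q) (f' : LevelRanking A) (O : Set Q)
    (i : Fin (A.rankBound + 1)) : Fin (A.rankBound + 1) :=
  if O ≠ ∅ then i
  else ⟨(i.val + 2) % (f'.maxRank + 1),
    (Nat.mod_lt _ (Nat.succ_pos _)).trans_le (Nat.succ_le_succ f'.maxRank_le)⟩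

open Classical in
/-- The next obligation set, where `f'` is the next level ranking and `i'` the next rank to be
checked. -/
noncomputable def nextObligation (A : NBW α Q) (f' : LevelRanking A) (O : Set Q)
    (i' : Fin (A.rankBound + 1)) (σ : α) : Set Q :=
  if O ≠ ∅ then A.post O σ \ f'.odd
  else {q | f'.rank q = some i'.val}

/-- The complement automaton that checks one even rank at a time. -/
noncomputable def schewe (A : NBW α Q) : NBW α (ScheweState A) where
  init := {Sum.inl A.initPreordered}
  ρ
    | Sum.inl P, σ =>
      {Sum.inr (A.toRank (A.succPreordered P σ), ∅, 0), Sum.inl (A.succPreordered P σ)}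
    | Sum.inr (f, O, i), σ =>
      {Sum.inr (f.succ σ,
        A.nextObligation (f.succ σ) O (A.nextIndex (f.succ σ) O i) σ,
        A.nextIndex (f.succ σ) O i)}
  F := {s | ∃ f : LevelRanking A, s = Sum.inr (f, ∅, 0)}

end NBW

/-! The complement automaton is deterministic apart from the level `k` at which it leaves the first
stage, so acceptance means that for some `k` the obligation set is empty with index 0 infinitely
often (`mem_language_schewe_iff`).

Soundness (`notMem_language_of_obligationSeq`): along any run of `A` the ranks never increase, so
they settle at some `v`. If the run is accepting, `v` is even. Infinitely many returns of the index
to 0 force a check of `v`, and that obligation would then contain the run forever.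

Completeness: let `w` be rejected by `A` and consider the runs in which each state is a maximal
predecessor of the next. Up to equivalence they are finitely many, and classes do not mix `F` with
its complement, so from one level on all of them avoid `F` (`exists_forall_isMaxRun_notMem`). From a
later level on, every state lies above one of them (`exists_forall_exists_isMaxRun_le`). Enter the
second stage there. Ranks are antitone for the preorder (`Agrees`), and maximal runs keep odd ranks.
So the largest rank is odd (or 0), which keeps the index even. An obligation that persisted would
yield a maximal run of even rank, by Kőnig's lemma (`exists_obligationSeq_eq_empty`). Hence the
index cycles through the even ranks and returns to 0 forever (`exists_index_eq_zero`). -/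

/-- Kőnig's lemma for layered graphs with a finite vertex set: if the layers `T j` are closed under
choosing a predecessor and arbitrarily late layers are nonempty, there is an infinite path. -/
theorem exists_path_of_layers {Q : Type*} [Finite Q] (T : ℕ → Set Q) (R : ℕ → Q → Q → Prop)
    (hback : ∀ j, ∀ q' ∈ T (j + 1), ∃ q ∈ T j, R j q q')
    (hne : ∀ n, ∃ m ≥ n, (T m).Nonempty) :
    ∃ p : ℕ → Q, ∀ j, p j ∈ T j ∧ R j (p j) (p (j + 1)) := by
  have key : ∀ m, ∀ q ∈ T m, ∃ c : ℕ → Q,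
      c m = q ∧ (∀ j ≤ m, c j ∈ T j) ∧ ∀ j < m, R j (c j) (c (j + 1)) := by
    intro m
    induction m with
    | zero =>
      intro q hq
      refine ⟨fun _ => q, rfl, fun j hj => ?_, fun j hj => by omega⟩
      obtain rfl : j = 0 := by omega
      exact hq
    | succ m ih =>
      intro q' hq'
      obtain ⟨q, hq, hR⟩ := hback m q' hq'
      obtain ⟨c, hc, hcT, hcR⟩ := ih q hq
      refine ⟨fun j => if j ≤ m then c j else q', by simp, fun j hj => ?_, fun j hj => ?_⟩
      · by_cases h : j ≤ m
        · simpa [h] using hcT j h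
        · obtain rfl : j = m + 1 := by omega
          simpa using hq'
      · by_cases h : j < m
        · have h1 : j ≤ m := by omega
          have h2 : j + 1 ≤ m := by omega
          simpa [h1, h2] using hcR j h
        · obtain rfl : j = m := by omega
          simpa [hc] using hR
  have hc : ∀ n, ∃ c : ℕ → Q, (∀ j ≤ n, c j ∈ T j) ∧ ∀ j < n, R j (c j) (c (j + 1)) := by
    intro n
    obtain ⟨m, hm, q, hq⟩ := hne n
    obtain ⟨c, -, h1, h2⟩ := key m q hq
    exact ⟨c, fun j hj => h1 j (hj.trans hm), fun j hj => h2 j (hj.trans_le hm)⟩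
  choose c hcT hcR using hc
  -- The chains `c n` converge along a nonprincipal ultrafilter: `Q` is finite, so each coordinate
  -- is constant on a large set of `n`.
  let U := Filter.hyperfilter ℕ
  have hU : ∀ j, ∃ q, ∀ᶠ n in (U : Filter ℕ), c n j = q := by
    intro j
    obtain ⟨q, hq⟩ := Ultrafilter.eq_pure_of_finite (U.map fun n => c n j)
    refine ⟨q, ?_⟩
    have h : ({q} : Set Q) ∈ U.map fun n => c n j := by rw [hq]; simp
    exact h
  choose p hp using hU
  refine ⟨p, fun j => ?_⟩
  have hlt : ∀ᶠ n in (U : Filter ℕ), j < n :=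
    Filter.hyperfilter_le_cofinite (by
      rw [Nat.cofinite_eq_atTop]; exact Filter.eventually_gt_atTop j)
  obtain ⟨n, ⟨h1, h2⟩, h3⟩ := (((hp j).and (hp (j + 1))).and hlt).exists
  rw [← h1, ← h2]
  exact ⟨hcT n j h3.le, hcR n j h3⟩

theorem exists_forall_eq_of_succ_le {g : ℕ → ℕ} (hg : ∀ n, g (n + 1) ≤ g n) :
    ∃ n, ∀ m ≥ n, g m = g n := by
  have hanti := antitone_nat_of_succ_le hg
  obtain ⟨n, hn⟩ := Nat.sInf_mem (Set.range_nonempty g)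
  exact ⟨n, fun m hm => le_antisymm (hanti hm) (hn ▸ Nat.sInf_le ⟨m, rfl⟩)⟩

namespace NBW

variable {α Q : Type*} [Finite α] [Finite Q]

/-! ### Monotonicity of tightening, and ranks along transitions. -/

namespace LevelRanking

variable {A : NBW α Q}

open Classical in
/-- The rank to which `tighten` sends the rank `r`. -/
noncomputable def tightValue (f : LevelRanking A) (r : ℕ) : ℕ :=
  if Even r then 2 * f.numOddBelow r else 2 * f.numOddBelow r + 1

theorem rank_tighten (f : LevelRanking A) {q : Q} {r : ℕ} (h : f.rank q = some r) :
    f.tighten.rank q = some (f.tightValue r) := by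
  simp [tighten, tightValue, h]

theorem rank_of_rank_tighten (f : LevelRanking A) {q : Q} {n : ℕ} (h : f.tighten.rank q = some n) :
    ∃ r, f.rank q = some r ∧ n = f.tightValue r := by
  obtain ⟨r, hr, rfl⟩ := Option.map_eq_some_iff.1 h
  exact ⟨r, hr, rfl⟩

theorem odd_tightValue (f : LevelRanking A) (r : ℕ) : Odd (f.tightValue r) ↔ Odd r := by
  unfold tightValue
  split_ifs with h
  · simp [← Nat.not_even_iff_odd, h]
  · simp [← Nat.not_even_iff_odd, h]

theorem tightValue_le (f : LevelRanking A) (r : ℕ) : f.tightValue r ≤ r := by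
  have h := f.numOddBelow_le r
  unfold tightValue
  split_ifs with he
  · omega
  · rw [Nat.not_even_iff] at he
    omega

theorem numOddBelow_mono (f : LevelRanking A) {a b : ℕ} (hab : a ≤ b) :
    f.numOddBelow a ≤ f.numOddBelow b :=
  Set.ncard_le_ncard (fun _ hs => ⟨hs.1, hs.2.1.trans_le hab, hs.2.2⟩)
    ((Set.finite_Iio b).subset fun _ hs => hs.2.1)

theorem numOddBelow_lt (f : LevelRanking A) {a b : ℕ} (hab : a < b) (ha : Odd a)
    {q : Q} (hq : f.rank q = some a) : f.numOddBelow a < f.numOddBelow b :=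
  Set.ncard_lt_ncard ⟨fun _ hs => ⟨hs.1, hs.2.1.trans hab, hs.2.2⟩,
    fun hsub => lt_irrefl a (hsub ⟨ha, hab, q, hq⟩).2.1⟩
    ((Set.finite_Iio b).subset fun _ hs => hs.2.1)

/-- That `a` is a value of `f` matters when `a` is odd and `b` even: `a` itself is then counted
below `b`, which pays for the `+ 1`. -/
theorem tightValue_mono (f : LevelRanking A) {a b : ℕ} (hab : a ≤ b)
    {q : Q} (hq : f.rank q = some a) : f.tightValue a ≤ f.tightValue b := by
  rcases hab.eq_or_lt with rfl | hlt
  · rfl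
  have h := f.numOddBelow_mono hab
  by_cases ha : Even a
  · unfold tightValue
    rw [if_pos ha]
    split_ifs <;> omega
  · have := f.numOddBelow_lt hlt (Nat.not_even_iff_odd.1 ha) hq
    unfold tightValue
    rw [if_neg ha]
    split_ifs <;> omega

theorem tightValue_lt (f : LevelRanking A) {a b : ℕ} (hab : a < b) (hb : Odd b)
    {q : Q} (hq : f.rank q = some a) : f.tightValue a < f.tightValue b := by
  have h := f.numOddBelow_mono hab.le
  rw [← Nat.not_even_iff_odd] at hb
  by_cases ha : Even a
  · unfold tightValue
    rw [if_pos ha, if_neg hb]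
    omega
  · have := f.numOddBelow_lt hab (Nat.not_even_iff_odd.1 ha) hq
    unfold tightValue
    rw [if_neg ha, if_neg hb]
    omega

theorem exists_rank_of_rank_succ (f : LevelRanking A) {σ : α} {q' : Q} {n : ℕ}
    (h : (f.succ σ).rank q' = some n) : ∃ q a, f.rank q = some a ∧ q' ∈ A.ρ q σ := by
  obtain ⟨r, hr, -⟩ := rank_of_rank_tighten _ h
  by_cases h0 : f.predRanks σ q' = ∅
  · simp [inherit, h0] at hr
  · obtain ⟨a, q, hq, hρ⟩ := Set.nonempty_iff_ne_empty.2 h0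
    exact ⟨q, a, hq, hρ⟩

theorem rank_succ_le (f : LevelRanking A) {σ : α} {q q' : Q} {a : ℕ} (hq : f.rank q = some a)
    (hρ : q' ∈ A.ρ q σ) : ∃ b ≤ a, (f.succ σ).rank q' = some b := by
  have hmem : a ∈ f.predRanks σ q' := ⟨q, hq, hρ⟩
  have hne : f.predRanks σ q' ≠ ∅ := Set.nonempty_iff_ne_empty.1 ⟨a, hmem⟩
  have hle : sInf (f.predRanks σ q') ≤ a := Nat.sInf_le hmem
  have : ∃ r ≤ a, (f.inherit σ).rank q' = some r := by
    by_cases hF : q' ∈ A.F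
    · exact ⟨_, (Nat.sub_le _ (sInf (f.predRanks σ q') % 2)).trans hle, by
        simp only [inherit, hne, hF, if_true, if_false]⟩
    · exact ⟨_, hle, by simp only [inherit, hne, hF, if_false]⟩
  obtain ⟨r, hr, h⟩ := this
  exact ⟨_, (tightValue_le _ r).trans hr, rank_tighten _ h⟩

theorem rank_le_maxRank (f : LevelRanking A) {q : Q} {n : ℕ} (h : f.rank q = some n) :
    n ≤ f.maxRank :=
  le_csSup ⟨A.rankBound, fun _ ⟨_, hq⟩ => f.bounded _ _ hq⟩ ⟨q, h⟩

theorem maxRank_eq_zero_or (f : LevelRanking A) :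
    f.maxRank = 0 ∨ ∃ q, f.rank q = some f.maxRank := by
  rcases Set.eq_empty_or_nonempty {n | ∃ q, f.rank q = some n} with h | h
  · left; simp [maxRank, h]
  · exact Or.inr (Nat.sSup_mem h ⟨A.rankBound, fun _ ⟨_, hq⟩ => f.bounded _ _ hq⟩)

theorem maxRank_succ_le (f : LevelRanking A) (σ : α) : (f.succ σ).maxRank ≤ f.maxRank := by
  rcases (f.succ σ).maxRank_eq_zero_or with h | ⟨q', hq'⟩
  · omega
  · obtain ⟨q, a, hq, hρ⟩ := f.exists_rank_of_rank_succ hq'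
    obtain ⟨b, hb, hb'⟩ := f.rank_succ_le hq hρ
    rw [hq'] at hb'
    obtain rfl := Option.some.inj hb'
    exact hb.trans (f.rank_le_maxRank hq)

end LevelRanking

/-! ### Compatibility of preorders and level rankings -/

/-- The level ranking `f` is defined on the states of `P`, is antitone for `P`, and takes each odd
rank on one class of `P` only. -/
structure Agrees {A : NBW α Q} (P : PreorderedSubset Q) (f : LevelRanking A) : Prop where
  mem_iff : ∀ q, q ∈ P.S ↔ ∃ n, f.rank q = some n
  anti : ∀ {q r a b}, P.le q r → f.rank q = some a → f.rank r = some b → b ≤ a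
  strict : ∀ {q r a b}, P.lt q r → f.rank q = some a → f.rank r = some b → Odd a → b < a

theorem preRank_mono (A : NBW α Q) (P : PreorderedSubset Q) {q r : Q} (h : P.le q r) :
    A.preRank P r ≤ A.preRank P q :=
  Set.ncard_le_ncard (fun _ ⟨v, hv, hlt, hC⟩ =>
    ⟨v, hv, ⟨P.trans _ _ _ h hlt.1, fun h' => hlt.2 (P.trans _ _ _ h' h)⟩, hC⟩) (Set.toFinite _)

/-- The class of `r` is counted for `q` but not for `r`. -/
theorem preRank_lt (A : NBW α Q) (P : PreorderedSubset Q) {q r : Q} (h : P.lt q r)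
    (hr : r ∉ A.F) : A.preRank P r < A.preRank P q := by
  have hrS := (P.supp _ _ h.1).2
  refine Set.ncard_lt_ncard ⟨fun _ ⟨v, hv, hlt, hC⟩ =>
    ⟨v, hv, ⟨P.trans _ _ _ h.1 hlt.1, fun h' => hlt.2 (P.trans _ _ _ h' h.1)⟩, hC⟩,
    fun hsub => ?_⟩ (Set.toFinite _)
  obtain ⟨v, -, hlt, hC⟩ := hsub ⟨r, ⟨hrS, hr⟩, h, rfl⟩
  have hrr : P.le r r := (P.total r hrS r hrS).elim id id
  have hmem : r ∈ P.cls v := hC ▸ (⟨hrr, hrr⟩ : P.equiv r r)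
  exact hlt.2 hmem.1

theorem agrees_toRank (A : NBW α Q) (P : PreorderedSubset Q)
    (hP : ∀ q r, P.equiv q r → q ∈ A.F → r ∈ A.F) : Agrees P (A.toRank P) := by
  have hval : ∀ {q n}, (A.toRank P).rank q = some n →
      q ∈ P.S ∧ ((q ∈ A.F ∧ n = 2 * A.preRank P q) ∨ (q ∉ A.F ∧ n = 2 * A.preRank P q + 1)) := by
    intro q n h
    simp only [toRank] at h
    split_ifs at h with hS hF
    · exact ⟨by simpa using hS, Or.inl ⟨hF, (Option.some.inj h).symm⟩⟩
    · exact ⟨by simpa using hS, Or.inr ⟨hF, (Option.some.inj h).symm⟩⟩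
  refine ⟨fun q => ⟨fun hS => ?_, fun ⟨n, h⟩ => (hval h).1⟩, ?_, ?_⟩
  · by_cases hF : q ∈ A.F
    · exact ⟨2 * A.preRank P q, by simp [toRank, hS, hF]⟩
    · exact ⟨2 * A.preRank P q + 1, by simp [toRank, hS, hF]⟩
  · intro q r a b hle ha hb
    have hm := A.preRank_mono P hle
    obtain ⟨-, ha⟩ := hval ha
    obtain ⟨-, hb⟩ := hval hb
    rcases ha with ⟨hqF, rfl⟩ | ⟨hqF, rfl⟩ <;> rcases hb with ⟨hrF, rfl⟩ | ⟨hrF, rfl⟩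
    · omega
    · have := A.preRank_lt P ⟨hle, fun h => hrF (hP q r ⟨hle, h⟩ hqF)⟩ hrF
      omega
    · omega
    · omega
  · intro q r a b hlt ha hb hodd
    have hm := A.preRank_mono P hlt.1
    obtain ⟨-, ha⟩ := hval ha
    obtain ⟨-, hb⟩ := hval hb
    rcases ha with ⟨hqF, rfl⟩ | ⟨hqF, rfl⟩
    · exact absurd (even_two_mul _) (Nat.not_even_iff_odd.2 hodd)
    · rcases hb with ⟨hrF, rfl⟩ | ⟨hrF, rfl⟩
      · omega
      · have := A.preRank_lt P hlt hrF
        omega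

/-- Maximal predecessors are unique up to equivalence, so the witnesses inside `succLe` can be
exchanged for any others. -/
theorem le_of_succLe {A : NBW α Q} {P : PreorderedSubset Q} {σ : α} {q r q' r' : Q}
    (h : A.succLe P σ q' r') (hq : q ∈ P.S) (hq' : q' ∈ A.maxPost P q σ)
    (hr' : r' ∈ A.maxPost P r σ) : P.le q r := by
  obtain ⟨s, hs, t, ht, hs', ht', h⟩ := h
  have hst : P.le s t := h.elim (fun x => x.1) fun x => x.1.1
  exact P.trans _ _ _ (hs'.2 q hq hq'.1) (P.trans _ _ _ hst (hr'.2 t ht ht'.1))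

theorem mem_of_succLe {A : NBW α Q} {P : PreorderedSubset Q} {σ : α} {q r q' r' : Q}
    (h : A.succLe P σ q' r') (hq : q ∈ P.S) (hq' : q' ∈ A.maxPost P q σ)
    (hr' : r' ∈ A.maxPost P r σ) (hrq : P.le r q) (hF : q' ∈ A.F) : r' ∈ A.F := by
  obtain ⟨s, hs, t, ht, hs', ht', h⟩ := h
  rcases h with h | h
  · exact absurd (P.trans _ _ _ (hr'.2 t ht ht'.1) (P.trans _ _ _ hrq (hs'.2 q hq hq'.1))) h.2
  · exact h.2 hF

namespace Agrees

variable {A : NBW α Q} {P : PreorderedSubset Q} {f : LevelRanking A} {σ : α}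

-- Since `f` is antitone, a maximal predecessor has the minimal rank among all predecessors; the
-- preorder and the ranking thus choose the same predecessors.
open Classical in
theorem rank_inherit (h : Agrees P f) {q q' : Q} {a : ℕ} (hq' : q' ∈ A.maxPost P q σ)
    (ha : f.rank q = some a) :
    (f.inherit σ).rank q' = some (if q' ∈ A.F then a - a % 2 else a) := by
  have hmem : a ∈ f.predRanks σ q' := ⟨q, ha, hq'.1⟩
  have hne : f.predRanks σ q' ≠ ∅ := Set.nonempty_iff_ne_empty.1 ⟨a, hmem⟩
  have hinf : sInf (f.predRanks σ q') = a := by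
    refine le_antisymm (Nat.sInf_le hmem) (le_csInf ⟨a, hmem⟩ ?_)
    rintro n ⟨r, hr, hρ⟩
    exact h.anti (hq'.2 r ((h.mem_iff r).2 ⟨n, hr⟩) hρ) hr ha
  simp only [LevelRanking.inherit, hne, if_false, hinf]
  split_ifs <;> rfl

theorem exists_maxPost_rank (h : Agrees P f) {q' : Q} (hq' : q' ∈ A.post P.S σ) :
    ∃ q ∈ P.S, q' ∈ A.maxPost P q σ ∧ ∃ a, f.rank q = some a := by
  obtain ⟨q, hq, hm⟩ := A.exists_maxPost P σ hq'
  exact ⟨q, hq, hm, (h.mem_iff q).1 hq⟩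

theorem succ (h : Agrees P f) : Agrees (A.succPreordered P σ) (f.succ σ) := by
  refine ⟨fun q' => ⟨fun hq' => ?_, fun ⟨n, hn⟩ => ?_⟩, ?_, ?_⟩
  · obtain ⟨q, -, hm, a, ha⟩ := h.exists_maxPost_rank hq'
    obtain ⟨b, -, hb⟩ := f.rank_succ_le ha hm.1
    exact ⟨b, hb⟩
  · obtain ⟨q, a, ha, hρ⟩ := f.exists_rank_of_rank_succ hn
    exact ⟨q, (h.mem_iff q).2 ⟨a, ha⟩, hρ⟩
  · intro q' r' a' b' hle ha' hb'
    obtain ⟨q, hq, hqm, a, ha⟩ := h.exists_maxPost_rank ((A.succPreordered P σ).supp _ _ hle).1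
    obtain ⟨r, hr, hrm, b, hb⟩ := h.exists_maxPost_rank ((A.succPreordered P σ).supp _ _ hle).2
    have hqr := le_of_succLe hle hq hqm hrm
    have hqi := h.rank_inherit hqm ha
    have hri := h.rank_inherit hrm hb
    rw [LevelRanking.succ, LevelRanking.rank_tighten _ hqi] at ha'
    rw [LevelRanking.succ, LevelRanking.rank_tighten _ hri] at hb'
    rw [← Option.some.inj ha', ← Option.some.inj hb']
    refine LevelRanking.tightValue_mono _ ?_ hri
    have hba := h.anti hqr ha hb
    split_ifs with h1 h2 h2
    · omega
    · omega
    -- Here `q'` is in `F` and `r'` is not. Rounding lowers an odd `a` by one, but then `q` is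
    -- strictly below `r`, since equivalent predecessors would put `r'` in `F`; so `b < a`.
    · rcases Nat.mod_two_eq_zero_or_one a with h0 | h0
      · omega
      · have := h.strict ⟨hqr, fun hrq => h1 (mem_of_succLe hle hq hqm hrm hrq h2)⟩ ha hb
          (Nat.odd_iff.2 h0)
        omega
    · exact hba
  · intro q' r' a' b' hlt ha' hb' hodd
    have hle := hlt.1
    obtain ⟨q, hq, hqm, a, ha⟩ := h.exists_maxPost_rank ((A.succPreordered P σ).supp _ _ hle).1
    obtain ⟨r, hr, hrm, b, hb⟩ := h.exists_maxPost_rank ((A.succPreordered P σ).supp _ _ hle).2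
    have hqr := le_of_succLe hle hq hqm hrm
    have hqi := h.rank_inherit hqm ha
    have hri := h.rank_inherit hrm hb
    rw [LevelRanking.succ, LevelRanking.rank_tighten _ hqi] at ha'
    rw [LevelRanking.succ, LevelRanking.rank_tighten _ hri] at hb'
    rw [← Option.some.inj ha', LevelRanking.odd_tightValue] at hodd
    rw [← Option.some.inj ha', ← Option.some.inj hb']
    refine LevelRanking.tightValue_lt _ ?_ hodd hri
    have hba := h.anti hqr ha hb
    have hqF : q' ∉ A.F := by
      intro hF
      rw [if_pos hF, Nat.odd_iff] at hodd
      omega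
    rw [if_neg hqF] at hodd ⊢
    by_cases hrq : P.le r q
    · have hrF : r' ∈ A.F := by
        by_contra hrF
        exact hlt.2 ⟨r, hr, q, hq, hrm, hqm, Or.inr ⟨⟨hrq, hqr⟩, fun hF => absurd hF hrF⟩⟩
      rw [if_pos hrF]
      rw [Nat.odd_iff] at hodd
      omega
    · have := h.strict ⟨hqr, hrq⟩ ha hb hodd
      split_ifs <;> omega

theorem odd_rank_succ (h : Agrees P f) {q q' : Q} {a : ℕ} (hq' : q' ∈ A.maxPost P q σ)
    (ha : f.rank q = some a) (hodd : Odd a) (hF : q' ∉ A.F) :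
    ∃ b, (f.succ σ).rank q' = some b ∧ Odd b := by
  have hi := h.rank_inherit hq' ha
  rw [if_neg hF] at hi
  exact ⟨_, LevelRanking.rank_tighten _ hi, (LevelRanking.odd_tightValue _ _).2 hodd⟩

end Agrees

/-! ### The first stage -/

/-- The preordered subset after reading the first `n` letters of `w`. -/
def preSeq (A : NBW α Q) (w : ℕ → α) : ℕ → PreorderedSubset Q
  | 0 => A.initPreordered
  | n + 1 => A.succPreordered (preSeq A w n) (w n)

/-- `p` is an infinite run of `A` on `w` in which each state is a maximal predecessor of the
next one. -/
def IsMaxRun (A : NBW α Q) (w : ℕ → α) (p : ℕ → Q) : Prop :=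
  p 0 ∈ A.init ∧ ∀ j, p (j + 1) ∈ A.maxPost (A.preSeq w j) (p j) (w j)

omit [Finite Q] in
theorem _root_.PreorderedSubset.le_refl {P : PreorderedSubset Q} {q : Q} (h : q ∈ P.S) :
    P.le q q :=
  (P.total q h q h).elim id id

theorem succLe_of_le {A : NBW α Q} {P : PreorderedSubset Q} {σ : α} {q r q' r' : Q}
    (h : P.le q r) (hq' : q' ∈ A.maxPost P q σ) (hr' : r' ∈ A.maxPost P r σ)
    (hF : q' ∉ A.F) : A.succLe P σ q' r' := by
  obtain ⟨hq, hr⟩ := P.supp _ _ h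
  refine ⟨q, hq, r, hr, hq', hr', ?_⟩
  by_cases hrq : P.le r q
  · exact Or.inr ⟨⟨h, hrq⟩, fun h' => absurd h' hF⟩
  · exact Or.inl ⟨h, hrq⟩

variable {A : NBW α Q} {w : ℕ → α}

/-- Both the initial preorder and the successor preorder separate `F` from its complement within
what would be one class. -/
theorem mem_of_equiv_preSeq (n : ℕ) (q r : Q) (h : (A.preSeq w n).equiv q r) (hF : q ∈ A.F) :
    r ∈ A.F := by
  cases n with
  | zero => exact h.1.2.2.resolve_left (not_not_intro hF)
  | succ n =>
    obtain ⟨hqS, hrS⟩ := (A.preSeq w (n + 1)).supp _ _ h.1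
    obtain ⟨q₀, hq₀, hqm⟩ := A.exists_maxPost _ _ hqS
    obtain ⟨r₀, hr₀, hrm⟩ := A.exists_maxPost _ _ hrS
    exact mem_of_succLe h.1 hq₀ hqm hrm (le_of_succLe h.2 hr₀ hrm hqm) hF

namespace IsMaxRun

variable {p p' : ℕ → Q}

theorem mem (hp : A.IsMaxRun w p) (j : ℕ) : p j ∈ (A.preSeq w j).S := by
  induction j with
  | zero => exact hp.1
  | succ j ih => exact ⟨p j, ih, (hp.2 j).1⟩

theorem exists_forall_notMem (hp : A.IsMaxRun w p) (hw : w ∉ A.language) :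
    ∃ n, ∀ j ≥ n, p j ∉ A.F := by
  by_contra! h
  refine hw ⟨p, ⟨hp.1, fun i => (hp.2 i).1⟩, Set.infinite_of_forall_exists_gt fun n => ?_⟩
  obtain ⟨j, hj, hF⟩ := h (n + 1)
  exact ⟨j, hF, by omega⟩

theorem equiv_of_le (hp : A.IsMaxRun w p) (hp' : A.IsMaxRun w p') {j n : ℕ} (hjn : j ≤ n)
    (h : (A.preSeq w n).equiv (p n) (p' n)) : (A.preSeq w j).equiv (p j) (p' j) := by
  induction n, hjn using Nat.le_induction with
  | base => exact h
  | succ n _ ih =>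
    exact ih ⟨le_of_succLe h.1 (hp.mem n) (hp.2 n) (hp'.2 n),
      le_of_succLe h.2 (hp'.mem n) (hp'.2 n) (hp.2 n)⟩

end IsMaxRun

/-- Two maximal runs are equivalent if they are so at every level. -/
def maxRunSetoid (A : NBW α Q) (w : ℕ → α) : Setoid {p // A.IsMaxRun w p} where
  r p p' := ∀ j, (A.preSeq w j).equiv (p.1 j) (p'.1 j)
  iseqv :=
    { refl := fun p j => ⟨PreorderedSubset.le_refl (p.2.mem j),
        PreorderedSubset.le_refl (p.2.mem j)⟩
      symm := fun h j => ⟨(h j).2, (h j).1⟩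
      trans := fun h h' j => ⟨(A.preSeq w j).trans _ _ _ (h j).1 (h' j).1,
        (A.preSeq w j).trans _ _ _ (h' j).2 (h j).2⟩ }

instance (A : NBW α Q) (w : ℕ → α) : Finite (Quotient (A.maxRunSetoid w)) := by
  by_contra hfin
  rw [not_finite_iff_infinite] at hfin
  -- At a level beyond all pairwise separations, inequivalent runs occupy distinct states, so there
  -- are at most `Nat.card Q` classes.
  obtain ⟨s, hs⟩ := Infinite.exists_subset_card_eq (Quotient (A.maxRunSetoid w)) (Nat.card Q + 1)
  have hsep : ∀ x y : Quotient (A.maxRunSetoid w), ∃ j, x ≠ y →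
      ¬ (A.preSeq w j).equiv (x.out.1 j) (y.out.1 j) := by
    intro x y
    by_contra! h
    refine (h 0).1 ?_
    rw [← x.out_eq, ← y.out_eq]
    exact Quotient.sound fun j => (h j).2
  choose g hg using hsep
  obtain ⟨N, hN⟩ := Finite.exists_le fun z : s × s => g z.1.1 z.2.1
  have hinj : Function.Injective fun x : s => x.1.out.1 N := by
    intro x y hxy
    by_contra hne
    refine hg x.1 y.1 (fun h => hne (Subtype.ext h))
      (x.1.out.2.equiv_of_le y.1.out.2 (hN (x, y)) ?_)
    have hxy : x.1.out.1 N = y.1.out.1 N := hxy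
    rw [← hxy]
    exact ⟨PreorderedSubset.le_refl (x.1.out.2.mem N), PreorderedSubset.le_refl (x.1.out.2.mem N)⟩
  have := Nat.card_le_card_of_injective _ hinj
  rw [Nat.card_eq_fintype_card, Fintype.card_coe, hs] at this
  omega

theorem exists_forall_isMaxRun_notMem (hw : w ∉ A.language) :
    ∃ n, ∀ p, A.IsMaxRun w p → ∀ j ≥ n, p j ∉ A.F := by
  choose g hg using fun c : Quotient (A.maxRunSetoid w) => c.out.2.exists_forall_notMem hw
  obtain ⟨N, hN⟩ := Finite.exists_le g
  refine ⟨N, fun p hp j hj hF => ?_⟩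
  have h : (A.maxRunSetoid w).r _ _ := Quotient.mk_out (s := A.maxRunSetoid w) ⟨p, hp⟩
  exact hg _ j ((hN _).trans hj) (mem_of_equiv_preSeq j _ _ ⟨(h j).2, (h j).1⟩ hF)

theorem exists_forall_exists_isMaxRun_le {n : ℕ} (hn : ∀ p, A.IsMaxRun w p → ∀ j ≥ n, p j ∉ A.F) :
    ∃ m ≥ n, ∀ j ≥ m, ∀ q ∈ (A.preSeq w j).S, ∃ p, A.IsMaxRun w p ∧ (A.preSeq w j).le (p j) q := by
  by_contra! hcon
  -- States strictly below every maximal run. The guard `n ≤ j` frees the early levels, so that the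
  -- path starts at level 0; it is then a maximal run strictly below itself.
  let T : ℕ → Set Q := fun j => {q | q ∈ (A.preSeq w j).S ∧
    (n ≤ j → ∀ p, A.IsMaxRun w p → (A.preSeq w j).lt q (p j))}
  have hback : ∀ j, ∀ q' ∈ T (j + 1), ∃ q ∈ T j, q' ∈ A.maxPost (A.preSeq w j) q (w j) := by
    rintro j q' ⟨hq', hlt⟩
    obtain ⟨q, hq, hm⟩ := A.exists_maxPost _ _ hq'
    refine ⟨q, ⟨hq, fun hj p hp => ?_⟩, hm⟩
    have h := hlt (by omega) p hp
    refine ⟨le_of_succLe h.1 hq hm (hp.2 j), fun hle => h.2 ?_⟩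
    exact succLe_of_le hle (hp.2 j) hm (hn p hp _ (by omega))
  have hne : ∀ N, ∃ j ≥ N, (T j).Nonempty := by
    intro N
    obtain ⟨j, hj, q, hq, h⟩ := hcon (max n N) (le_max_left _ _)
    refine ⟨j, (le_max_right _ _).trans hj, q, hq, fun _ p hp => ?_⟩
    exact ⟨((A.preSeq w j).total _ hq _ (hp.mem j)).resolve_right (h p hp), h p hp⟩
  obtain ⟨p, hp⟩ := exists_path_of_layers T _ hback hne
  have hmax : A.IsMaxRun w p := ⟨(hp 0).1.1, fun j => (hp j).2⟩
  have := (hp n).1.2 le_rfl p hmax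
  exact this.2 this.1

/-! ### The second stage -/

/-- The level ranking `n` letters after the second stage is entered at level `k`. -/
noncomputable def rankSeq (A : NBW α Q) (w : ℕ → α) (k : ℕ) : ℕ → LevelRanking A
  | 0 => A.toRank (A.preSeq w k)
  | n + 1 => (rankSeq A w k n).succ (w (k + n))

/-- The obligation set and the index `n` letters after the second stage is entered at
level `k`. -/
noncomputable def obligationSeq (A : NBW α Q) (w : ℕ → α) (k : ℕ) :
    ℕ → Set Q × Fin (A.rankBound + 1)
  | 0 => (∅, 0)
  | n + 1 =>
    let s := obligationSeq A w k n
    (A.nextObligation (A.rankSeq w k (n + 1)) s.1 (A.nextIndex (A.rankSeq w k (n + 1)) s.1 s.2)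
      (w (k + n)), A.nextIndex (A.rankSeq w k (n + 1)) s.1 s.2)

variable {k : ℕ}

theorem agrees_rankSeq (A : NBW α Q) (w : ℕ → α) (k n : ℕ) :
    Agrees (A.preSeq w (k + n)) (A.rankSeq w k n) := by
  induction n with
  | zero => exact A.agrees_toRank _ (mem_of_equiv_preSeq k)
  | succ n ih => exact ih.succ

theorem odd_rankSeq (hk : ∀ p, A.IsMaxRun w p → ∀ j ≥ k, p j ∉ A.F) {p : ℕ → Q}
    (hp : A.IsMaxRun w p) (n : ℕ) :
    ∃ b, (A.rankSeq w k n).rank (p (k + n)) = some b ∧ Odd b := by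
  induction n with
  | zero =>
    refine ⟨2 * A.preRank (A.preSeq w k) (p k) + 1, ?_, odd_two_mul_add_one _⟩
    simp [rankSeq, toRank, hp.mem k, hk p hp k le_rfl]
  | succ n ih =>
    obtain ⟨a, ha, hodd⟩ := ih
    exact (agrees_rankSeq A w k n).odd_rank_succ (hp.2 (k + n)) ha hodd
      (hk p hp (k + n + 1) (by omega))

/-- A state of largest rank lies above a maximal run, whose odd rank is at least as large. -/
theorem maxRank_rankSeq (hk : ∀ p, A.IsMaxRun w p → ∀ j ≥ k, p j ∉ A.F)
    (hk' : ∀ j ≥ k, ∀ q ∈ (A.preSeq w j).S, ∃ p, A.IsMaxRun w p ∧ (A.preSeq w j).le (p j) q)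
    (n : ℕ) : (A.rankSeq w k n).maxRank = 0 ∨ Odd (A.rankSeq w k n).maxRank := by
  refine (A.rankSeq w k n).maxRank_eq_zero_or.imp_right fun ⟨q, hq⟩ => ?_
  have hagr := agrees_rankSeq A w k n
  obtain ⟨p, hp, hle⟩ := hk' (k + n) (by omega) q ((hagr.mem_iff q).2 ⟨_, hq⟩)
  obtain ⟨b, hb, hodd⟩ := odd_rankSeq hk hp n
  have h1 := hagr.anti hle hb hq
  rwa [le_antisymm h1 ((A.rankSeq w k n).rank_le_maxRank hb)]

theorem obligationSeq_succ_of_ne {n : ℕ} (h : (A.obligationSeq w k n).1 ≠ ∅) :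
    (A.obligationSeq w k (n + 1)).2 = (A.obligationSeq w k n).2 ∧
    (A.obligationSeq w k (n + 1)).1 =
      A.post (A.obligationSeq w k n).1 (w (k + n)) \ (A.rankSeq w k (n + 1)).odd := by
  simp [obligationSeq, nextIndex, nextObligation, h]

theorem obligationSeq_succ_of_eq {n : ℕ} (h : (A.obligationSeq w k n).1 = ∅) :
    ((A.obligationSeq w k (n + 1)).2 : ℕ) =
      ((A.obligationSeq w k n).2 + 2) % ((A.rankSeq w k (n + 1)).maxRank + 1) ∧
    (A.obligationSeq w k (n + 1)).1 =
      {q | (A.rankSeq w k (n + 1)).rank q = some (A.obligationSeq w k (n + 1)).2.val} := by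
  simp [obligationSeq, nextIndex, nextObligation, h]

theorem obligationSeq_subset (n : ℕ) :
    (A.obligationSeq w k n).1 ⊆ (A.preSeq w (k + n)).S := by
  induction n with
  | zero => exact Set.empty_subset _
  | succ n ih =>
    intro q' hq'
    by_cases h : (A.obligationSeq w k n).1 = ∅
    · rw [(obligationSeq_succ_of_eq h).2] at hq'
      exact ((agrees_rankSeq A w k (n + 1)).mem_iff q').2 ⟨_, hq'⟩
    · rw [(obligationSeq_succ_of_ne h).2] at hq'
      obtain ⟨⟨q, hq, hρ⟩, -⟩ := hq'
      exact ⟨q, ih hq, hρ⟩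

/-- The index changes only on leaving an empty obligation set, so it survives until the next one. -/
theorem exists_eq_empty_of_index_eq
    (h : ∀ n, ∃ m ≥ n, (A.obligationSeq w k m).1 = ∅) (n : ℕ) :
    ∃ m ≥ n, (A.obligationSeq w k m).1 = ∅ ∧
      (A.obligationSeq w k m).2 = (A.obligationSeq w k n).2 := by
  obtain ⟨m, hm, hO⟩ := h n
  obtain ⟨d, rfl⟩ := Nat.exists_eq_add_of_le hm
  clear hm
  induction d generalizing n with
  | zero => exact ⟨n, le_rfl, hO, rfl⟩
  | succ d ih =>
    by_cases hn : (A.obligationSeq w k n).1 = ∅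
    · exact ⟨n, le_rfl, hn, rfl⟩
    · obtain ⟨m, hm, h1, h2⟩ := ih (n + 1) (by rwa [add_right_comm, add_assoc])
      exact ⟨m, by omega, h1, h2.trans (obligationSeq_succ_of_ne hn).1⟩

/-- If maximal runs avoid `F` from level `k` on, then no obligation persists forever. -/
theorem exists_obligationSeq_eq_empty (hk : ∀ p, A.IsMaxRun w p → ∀ j ≥ k, p j ∉ A.F) (n : ℕ) :
    ∃ m ≥ n, (A.obligationSeq w k m).1 = ∅ := by
  by_contra! hcon
  -- Starting at `n + 1` makes every layer the successor of a nonempty obligation, hence free of odd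
  -- ranks.
  obtain ⟨q, hq⟩ := exists_path_of_layers (fun i => (A.obligationSeq w k (n + 1 + i)).1)
    (fun i q q' => q' ∈ A.ρ q (w (k + (n + 1 + i))))
    (fun i q' hq' => by
      rw [show n + 1 + (i + 1) = n + 1 + i + 1 from rfl,
        (obligationSeq_succ_of_ne (hcon (n + 1 + i) (by omega)).ne_empty).2] at hq'
      exact hq'.1)
    (fun i => ⟨i, le_rfl, hcon (n + 1 + i) (by omega)⟩)
  have hS : ∀ i, q i ∈ (A.preSeq w (k + (n + 1 + i))).S :=
    fun i => obligationSeq_subset _ (hq i).1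
  choose g hg using fun i => ((agrees_rankSeq A w k (n + 1 + i)).mem_iff (q i)).1 (hS i)
  have hodd : ∀ i, ¬ Odd (g i) := by
    intro i ho
    have h := (hq i).1
    rw [show n + 1 + i = n + i + 1 by omega,
      (obligationSeq_succ_of_ne (hcon (n + i) (by omega)).ne_empty).2,
      show n + i + 1 = n + 1 + i by omega] at h
    exact h.2 ⟨g i, hg i, ho⟩
  have hanti : ∀ i, g (i + 1) ≤ g i := by
    intro i
    obtain ⟨b, hb, h⟩ := LevelRanking.rank_succ_le _ (hg i) (hq i).2
    have h' : some (g (i + 1)) = some b := (hg (i + 1)).symm.trans h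
    rwa [Option.some.inj h']
  obtain ⟨N, hN⟩ := exists_forall_eq_of_succ_le hanti
  -- States above `q i` that share its final rank. A maximal predecessor stays in the set: its rank
  -- is at most that of `q i` by antitonicity, and at least that of its successor.
  let T : ℕ → Set Q := fun j => {u | u ∈ (A.preSeq w j).S ∧ ∀ i ≥ N, j = k + (n + 1 + i) →
    (A.preSeq w j).le (q i) u ∧ (A.rankSeq w k (n + 1 + i)).rank u = some (g N)}
  have hback : ∀ j, ∀ u' ∈ T (j + 1), ∃ u ∈ T j, u' ∈ A.maxPost (A.preSeq w j) u (w j) := by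
    rintro j u' ⟨hu', hu⟩
    obtain ⟨u, huS, hm⟩ := A.exists_maxPost _ _ hu'
    refine ⟨u, ⟨huS, ?_⟩, hm⟩
    rintro i hi rfl
    obtain ⟨hle, hrank⟩ := hu (i + 1) (by omega) rfl
    obtain ⟨t, ht, htm⟩ := A.exists_maxPost _ _ (hS (i + 1))
    have hqu := (A.preSeq w (k + (n + 1 + i))).trans _ _ _ (htm.2 (q i) (hS i) (hq i).2)
      (le_of_succLe hle ht htm hm)
    refine ⟨hqu, ?_⟩
    have hagr := agrees_rankSeq A w k (n + 1 + i)
    obtain ⟨a, ha⟩ := (hagr.mem_iff u).1 huS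
    have h1 := hagr.anti hqu (hg i) ha
    obtain ⟨b, hb, h2⟩ := LevelRanking.rank_succ_le _ ha hm.1
    have h3 : some b = some (g N) := h2.symm.trans hrank
    have := Option.some.inj h3
    have := hN i hi
    rw [ha, show a = g N by omega]
  have hne : ∀ M, ∃ j ≥ M, (T j).Nonempty := by
    intro M
    refine ⟨k + (n + 1 + max M N), by omega, q (max M N), hS _, fun i hi h => ?_⟩
    obtain rfl : i = max M N := by omega
    exact ⟨PreorderedSubset.le_refl (hS _), (hg _).trans (by rw [hN _ hi])⟩
  obtain ⟨p, hp⟩ := exists_path_of_layers T _ hback hne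
  have hmax : A.IsMaxRun w p := ⟨(hp 0).1.1, fun j => (hp j).2⟩
  obtain ⟨b, hb, ho⟩ := odd_rankSeq hk hmax (n + 1 + N)
  rw [((hp _).1.2 N le_rfl rfl).2] at hb
  exact hodd N (Option.some.inj hb ▸ ho)

theorem exists_index_eq_zero (hk : ∀ p, A.IsMaxRun w p → ∀ j ≥ k, p j ∉ A.F)
    (hk' : ∀ j ≥ k, ∀ q ∈ (A.preSeq w j).S, ∃ p, A.IsMaxRun w p ∧ (A.preSeq w j).le (p j) q)
    (n : ℕ) :
    ∃ m ≥ n, (A.obligationSeq w k m).1 = ∅ ∧ (A.obligationSeq w k m).2 = 0 := by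
  have hempty := exists_obligationSeq_eq_empty hk
  have hmax := maxRank_rankSeq hk hk'
  have heven : ∀ j, Even ((A.obligationSeq w k j).2 : ℕ) := by
    intro j
    induction j with
    | zero => simp [obligationSeq]
    | succ j ih =>
      by_cases h : (A.obligationSeq w k j).1 = ∅
      · rw [(obligationSeq_succ_of_eq h).1]
        rcases hmax (j + 1) with h0 | h0
        · simp [h0, Nat.mod_one]
        · have h2 : Even ((A.obligationSeq w k j).2 + 2 : ℕ) := ih.add even_two
          exact (Nat.even_iff.2 (by
            rw [Nat.mod_mod_of_dvd _ (Odd.add_one h0).two_dvd]; exact Nat.even_iff.1 h2))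
      · rwa [(obligationSeq_succ_of_ne h).1]
  obtain ⟨N, hN⟩ := exists_forall_eq_of_succ_le (g := fun j => (A.rankSeq w k j).maxRank)
    fun j => LevelRanking.maxRank_succ_le _ _
  generalize hM : (A.rankSeq w k N).maxRank = M at hN
  have hstep : ∀ j ≥ N, (A.obligationSeq w k j).1 = ∅ →
      ((A.obligationSeq w k (j + 1)).2 : ℕ) = ((A.obligationSeq w k j).2 + 2) % (M + 1) := by
    intro j hj hO
    rw [(obligationSeq_succ_of_eq hO).1, hN (j + 1) (by omega)]
  have hM' : M = 0 ∨ Odd M := hM ▸ hmax N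
  -- `d` bounds the distance from the index up to `M`. For odd `M` the even index ends at `M - 1`,
  -- and the next step gives `M + 1`, which wraps to 0.
  have key : ∀ d, ∀ j ≥ N, (A.obligationSeq w k j).1 = ∅ →
      M ≤ (A.obligationSeq w k j).2 + d → (A.obligationSeq w k j).2 ≤ M →
      ∃ m ≥ j, (A.obligationSeq w k m).1 = ∅ ∧ (A.obligationSeq w k m).2 = 0 := by
    intro d
    induction d with
    | zero =>
      intro j hj hO h1 h2
      refine ⟨j, le_rfl, hO, Fin.ext ?_⟩
      rw [Fin.val_zero]
      have he := Nat.even_iff.1 (heven j)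
      rcases hM' with h | h
      · omega
      · rw [Nat.odd_iff] at h
        omega
    | succ d ih =>
      intro j hj hO h1 h2
      obtain ⟨m, hm, hOm, him⟩ := exists_eq_empty_of_index_eq hempty (j + 1)
      have hi := hstep j hj hO
      rw [← him] at hi
      have he := Nat.even_iff.1 (heven j)
      by_cases h : ((A.obligationSeq w k j).2 : ℕ) + 2 ≤ M
      · rw [Nat.mod_eq_of_lt (by omega)] at hi
        obtain ⟨m', hm', h'⟩ := ih m (by omega) hOm (by omega) (by omega)
        exact ⟨m', by omega, h'⟩
      · refine ⟨m, by omega, hOm, Fin.ext ?_⟩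
        rw [hi]
        rcases hM' with h0 | h0
        · simp [h0, Nat.mod_one]
        · rw [Nat.odd_iff] at h0
          rw [show ((A.obligationSeq w k j).2 : ℕ) + 2 = M + 1 by omega, Nat.mod_self]
          rfl
  -- The index may still exceed `M` here, as the largest rank has dropped; one reduction modulo `M +
  -- 1` brings it into range.
  obtain ⟨j, hj, hO⟩ := hempty (max n N)
  obtain ⟨m, hm, hOm, him⟩ := exists_eq_empty_of_index_eq hempty (j + 1)
  have hlt := Nat.mod_lt ((A.obligationSeq w k j).2 + 2 : ℕ) (Nat.succ_pos M)
  have hi := hstep j (by omega) hO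
  rw [← him] at hi
  rw [Nat.succ_eq_add_one, ← hi] at hlt
  obtain ⟨m', hm', h'⟩ := key M m (by omega) hOm (by omega) (by omega)
  exact ⟨m', by omega, h'⟩

/-! ### Runs of the complement automaton -/

/-- A run that stays in the first stage never accepts, and entering the second stage consumes a
letter, whence `k ≥ 1`. -/
theorem mem_language_schewe_iff : w ∈ A.schewe.language ↔
    ∃ k ≥ 1, ∀ n, ∃ m ≥ n, (A.obligationSeq w k m).1 = ∅ ∧ (A.obligationSeq w k m).2 = 0 := by
  constructor
  · rintro ⟨r, ⟨hr0, hr⟩, hF⟩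
    have hstep : ∀ k n j, r j = Sum.inr (A.rankSeq w k n, A.obligationSeq w k n) → j = k + n →
        r (j + 1) = Sum.inr (A.rankSeq w k (n + 1), A.obligationSeq w k (n + 1)) := by
      rintro k n j h rfl
      have h' := hr (k + n)
      rw [h] at h'
      exact h'
    have hform : ∀ j, r j = Sum.inl (A.preSeq w j) ∨ ∃ k ≥ 1, ∃ n, j = k + n ∧
        r j = Sum.inr (A.rankSeq w k n, A.obligationSeq w k n) := by
      intro j
      induction j with
      | zero => exact Or.inl hr0
      | succ j ih =>
        rcases ih with h | ⟨k, hk, n, hj, h⟩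
        · have h' := hr j
          rw [h] at h'
          rcases h' with h' | h'
          · exact Or.inr ⟨j + 1, by omega, 0, rfl, h'⟩
          · exact Or.inl h'
        · exact Or.inr ⟨k, hk, n + 1, by omega, hstep k n j h hj⟩
    obtain ⟨j, f, hf⟩ := hF.nonempty
    rcases hform j with h | ⟨k, hk, n₀, rfl, h⟩
    · exact absurd (h.symm.trans hf) Sum.inl_ne_inr
    have hall : ∀ n ≥ n₀, r (k + n) = Sum.inr (A.rankSeq w k n, A.obligationSeq w k n) := by
      intro n hn
      induction n, hn using Nat.le_induction with
      | base => exact h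
      | succ n _ ih => exact hstep k n _ ih rfl
    refine ⟨k, hk, fun n => ?_⟩
    obtain ⟨i, ⟨g, hg⟩, hi⟩ := hF.exists_gt (k + max n n₀)
    obtain ⟨m, rfl⟩ := Nat.exists_eq_add_of_le (show k ≤ i by omega)
    rw [hall m (by omega)] at hg
    have := congrArg Prod.snd (Sum.inr.inj hg)
    exact ⟨m, by omega, congrArg Prod.fst this, congrArg Prod.snd this⟩
  · rintro ⟨k, hk, h⟩
    refine ⟨fun j => if j < k then Sum.inl (A.preSeq w j)
      else Sum.inr (A.rankSeq w k (j - k), A.obligationSeq w k (j - k)), ⟨?_, fun j => ?_⟩, ?_⟩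
    · beta_reduce
      rw [if_pos (by omega)]
      rfl
    · beta_reduce
      rcases lt_trichotomy (j + 1) k with hj | rfl | hj
      · rw [if_pos hj, if_pos (by omega)]
        exact Or.inr rfl
      · rw [if_neg (lt_irrefl (j + 1)), if_pos (Nat.lt_succ_self j), Nat.sub_self]
        exact Or.inl rfl
      · obtain ⟨n, rfl⟩ := Nat.exists_eq_add_of_le (show k ≤ j by omega)
        rw [if_neg (by omega), if_neg (by omega), Nat.add_assoc, Nat.add_sub_cancel_left,
          Nat.add_sub_cancel_left]
        exact rfl
    · refine Set.infinite_of_forall_exists_gt fun n => ?_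
      obtain ⟨m, hm, hO, hi⟩ := h (n + 1)
      refine ⟨k + m, ⟨A.rankSeq w k m, ?_⟩, by omega⟩
      beta_reduce
      rw [if_neg (by omega), Nat.add_sub_cancel_left, ← hO, ← hi]

theorem notMem_language_of_obligationSeq
    (h : ∀ n, ∃ m ≥ n, (A.obligationSeq w k m).1 = ∅ ∧ (A.obligationSeq w k m).2 = 0) :
    w ∉ A.language := by
  rintro ⟨p, ⟨hp0, hp⟩, hF⟩
  have hS : ∀ j, p j ∈ (A.preSeq w j).S := by
    intro j
    induction j with
    | zero => exact hp0
    | succ j ih => exact ⟨p j, ih, hp j⟩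
  choose g hg using fun n => ((agrees_rankSeq A w k n).mem_iff (p (k + n))).1 (hS (k + n))
  have hanti : ∀ n, g (n + 1) ≤ g n := by
    intro n
    obtain ⟨b, hb, h⟩ := LevelRanking.rank_succ_le _ (hg n) (hp (k + n))
    have h' : some (g (n + 1)) = some b := (hg (n + 1)).symm.trans h
    rwa [Option.some.inj h']
  obtain ⟨N, hN⟩ := exists_forall_eq_of_succ_le hanti
  generalize g N = v at hN
  have hv : Even v := by
    obtain ⟨i, hi, hlt⟩ := hF.exists_gt (k + N)
    obtain ⟨n, rfl⟩ := Nat.exists_eq_add_of_le (show k ≤ i by omega)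
    rw [← hN n (by omega)]
    exact (A.rankSeq w k n).even_of_mem _ _ hi (hg n)
  have hempty : ∀ n, ∃ m ≥ n, (A.obligationSeq w k m).1 = ∅ := fun n =>
    (h n).imp fun m hm => ⟨hm.1, hm.2.1⟩
  -- Once rank `v` is being checked, the run is in the obligation set and never leaves it, its rank
  -- being even.
  have hne : ∀ j ≥ N, (A.obligationSeq w k j).1 = ∅ →
      ((A.obligationSeq w k (j + 1)).2 : ℕ) ≠ v := by
    intro j hj hO hi
    have hmem : ∀ m ≥ j + 1, p (k + m) ∈ (A.obligationSeq w k m).1 := by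
      intro m hm
      induction m, hm using Nat.le_induction with
      | base =>
        rw [(obligationSeq_succ_of_eq hO).2, hi, ← hN (j + 1) (by omega)]
        exact hg (j + 1)
      | succ m hm ih =>
        rw [(obligationSeq_succ_of_ne (Set.nonempty_iff_ne_empty.1 ⟨_, ih⟩)).2]
        refine ⟨⟨_, ih, hp (k + m)⟩, ?_⟩
        rintro ⟨n, hn, hodd⟩
        have h' : some n = some (g (m + 1)) := hn.symm.trans (hg (m + 1))
        rw [Option.some.inj h', hN (m + 1) (by omega)] at hodd
        exact Nat.not_even_iff_odd.2 hodd hv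
    obtain ⟨m, hm, hO'⟩ := hempty (j + 1)
    exact Set.nonempty_iff_ne_empty.1 ⟨_, hmem m hm⟩ hO'
  obtain ⟨m₀, hm₀, hO₀, hi₀⟩ := h N
  obtain ⟨s, rfl⟩ := even_iff_two_dvd.1 hv
  rcases Nat.eq_zero_or_pos s with rfl | hs
  · have hpos : ∀ m ≥ m₀ + 1, ((A.obligationSeq w k m).2 : ℕ) ≠ 0 := by
      intro m hm
      induction m, hm using Nat.le_induction with
      | base => exact hne m₀ hm₀ hO₀
      | succ m hm ih =>
        by_cases hO : (A.obligationSeq w k m).1 = ∅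
        · exact hne m (by omega) hO
        · rwa [(obligationSeq_succ_of_ne hO).1]
    obtain ⟨m, hm, -, hi⟩ := h (m₀ + 1)
    exact hpos m hm (by rw [hi]; rfl)
  -- The run itself has rank `2 * s`, so the largest rank is at least that and the index climbs from
  -- 0 to `2 * s` without wrapping.
  · have hreach : ∀ t < s, ∃ j ≥ N, (A.obligationSeq w k j).1 = ∅ ∧
        ((A.obligationSeq w k j).2 : ℕ) = 2 * t := by
      intro t
      induction t with
      | zero => exact fun _ => ⟨m₀, hm₀, hO₀, by rw [hi₀]; rfl⟩
      | succ t ih =>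
        intro ht
        obtain ⟨j, hj, hO, hi⟩ := ih (by omega)
        obtain ⟨m, hm, hOm, him⟩ := exists_eq_empty_of_index_eq hempty (j + 1)
        have hle := (A.rankSeq w k (j + 1)).rank_le_maxRank (hg (j + 1))
        rw [hN (j + 1) (by omega)] at hle
        refine ⟨m, by omega, hOm, ?_⟩
        rw [him, (obligationSeq_succ_of_eq hO).1, hi, Nat.mod_eq_of_lt (by omega)]
        ring
    obtain ⟨j, hj, hO, hi⟩ := hreach (s - 1) (by omega)
    have hle := (A.rankSeq w k (j + 1)).rank_le_maxRank (hg (j + 1))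
    rw [hN (j + 1) (by omega)] at hle
    refine hne j hj hO ?_
    rw [(obligationSeq_succ_of_eq hO).1, hi, Nat.mod_eq_of_lt (by omega)]
    omega

end NBW

theorem mainTheorem4 {α Q : Type*} [Finite α] [Finite Q] (A : NBW α Q) :
    A.schewe.language = (A.language)ᶜ := by
  ext w
  rw [NBW.mem_language_schewe_iff, Set.mem_compl_iff]
  constructor
  · rintro ⟨k, -, h⟩
    exact NBW.notMem_language_of_obligationSeq h
  · intro hw
    obtain ⟨n, hn⟩ := NBW.exists_forall_isMaxRun_notMem hw
    obtain ⟨m, hm, hmin⟩ := NBW.exists_forall_exists_isMaxRun_le hn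
    refine ⟨m + 1, by omega, NBW.exists_index_eq_zero (fun p hp j hj => hn p hp j (by omega))
      fun j hj => hmin j (by omega)⟩
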